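/- Let $\mathcal H_B\cong\mathbb C^N$ and let $\rho$ be a density operator of full rank $N$ on it. Let $\{e_k\}$ be an orthonormal basis of eigenvectors of $\rho$, and let ${}^tT$ denote the transpose of an operator $T$ in this basis. Let $\{p_i,\rho_i\}$ and $\{q_l,\sigma_l\}$ be two finite ensembles of density operators (with $p_i,q_l\ge 0$ and $\sum_i p_i=\sum_l q_l=1$) such that $\rho=\sum_i p_i\rho_i=\sum_l q_l\sigma_l$. Let $X$ and $Y$ be random variables with $\Pr(X=i)=p_i$ and $\Pr(Y=l)=q_l$. Let $({\mathcal H}_E,|\Omega\rangle,U)$ be an eavesdropping attack, that is, a finite-dimensional Hilbert space $\mathcal H_E$, a unit vector $|\Omega\rangle\in\mathcal H_E$ and a unitary operator $U$ on $\mathcal H_B\otimes\mathcal H_E$. If Alice encodes $X$ (respectively $Y$), then, given $X=i$ (respectively $Y=l$), the joint state of Bob and Eve is $U(\rho_i\otimes|\Omega\rangle\langle\Omega|)U^*$ (respectively $U(\sigma_l\otimes|\Omega\rangle\langle\Omega|)U^*$). Let $I(X:B)$ (respectively $I(X:E)$) be the supremum, over all POVMs with finitely many outcomes on $\mathcal H_B$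 (respectively $\mathcal H_E$), of the mutual information between $X$ and the measurement outcome when Alice encodes $X$; define $I(Y:B)$ and $I(Y:E)$ in the same way, with Alice encoding $Y$. Let $H$ be the Shannon entropy, let all logarithms be to one fixed base greater than $1$, and let $$F[\{p_j,\rho_j\}]_i=p_i\,\rho^{-1/2}\,{}^t\rho_i\,\rho^{-1/2},\qquad F[\{q_j,\sigma_j\}]_k=q_k\,\rho^{-1/2}\,{}^t\sigma_k\,\rho^{-1/2}.$$ Then these four suprema are finite and, with the operator norm $\|\cdot\|$, $$I(X:B)+I(Y:E)\le H(X)+H(Y)+2\log\max_{i,k}\bigl\|F[\{p_j,\rho_j\}]_i^{1/2}\,F[\{q_l,\sigma_l\}]_k^{1/2}\bigr\|,$$ $$I(X:E)+I(Y:B)\le H(X)+H(Y)+2\log\max_{i,k}\bigl\|F[\{p_j,\rho_j\}]_i^{1/2}\,F[\{q_l,\sigma_l\}]_k^{1/2}\bigr\|.$$ -/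

import Mathlib

open scoped Matrix Kronecker ComplexOrder MatrixOrder

namespace QInfo

/-- A density operator on `ℂⁿ`: positive (semidefinite) with unit trace. -/
def IsDensity {n : Type*} [Fintype n] (ρ : Matrix n n ℂ) : Prop :=
  ρ.PosSemidef ∧ ρ.trace = 1

/-- An ensemble `{pᵢ, ρᵢ}` of states on `ℂⁿ`, with labels in the finite set `ι`. The label drawn
with the probabilities `pᵢ` is the random variable that the ensemble encodes. -/
structure Ensemble (ι n : Type*) [Fintype ι] [Fintype n] where
  /-- the probabilities -/
  prob : ι → ℝ
  /-- the states -/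
  state : ι → Matrix n n ℂ
  prob_nonneg : ∀ i, 0 ≤ prob i
  sum_prob : ∑ i, prob i = 1
  state_density : ∀ i, IsDensity (state i)

/-- The average state `∑ᵢ pᵢ ρᵢ` of an ensemble. -/
def Ensemble.average {ι n : Type*} [Fintype ι] [Fintype n] (X : Ensemble ι n) : Matrix n n ℂ :=
  ∑ i, (X.prob i : ℂ) • X.state i

/-- A positive operator valued measure on `ℂⁿ` with finite outcome set `β`. -/
structure POVM (β n : Type*) [Fintype β] [Fintype n] [DecidableEq n] where
  /-- the operator that belongs to an outcome -/
  effect : β → Matrix n n ℂ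
  effect_posSemidef : ∀ b, (effect b).PosSemidef
  sum_effect : ∑ b, effect b = 1

/-- An eavesdropping attack on a system `ℂⁿ`: an apparatus `ℂᵉ`, its initial unit vector `Ω` and a
unitary operator `U` on `ℂⁿ ⊗ ℂᵉ`. -/
structure Attack (n e : Type*) [Fintype n] [Fintype e] [DecidableEq n] [DecidableEq e] where
  /-- the initial vector of the apparatus -/
  Ω : e → ℂ
  /-- the interaction -/
  U : Matrix (n × e) (n × e) ℂ
  Ω_unit : star Ω ⬝ᵥ Ω = 1
  U_unitary : U ∈ Matrix.unitaryGroup (n × e) ℂ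

section Information

variable {ι β n e : Type*} [Fintype ι] [Fintype β] [Fintype n] [Fintype e]
  [DecidableEq n] [DecidableEq e]

/-- The state `U (τ ⊗ |Ω⟩⟨Ω|) U*` of system and apparatus after the attack, for the input `τ`. -/
def Attack.output (A : Attack n e) (τ : Matrix n n ℂ) : Matrix (n × e) (n × e) ℂ :=
  A.U * (τ ⊗ₖ Matrix.vecMulVec A.Ω (star A.Ω)) * A.Uᴴ

/-- The joint distribution of the encoded label and of the outcome when Bob measures `M` on the
received system. -/
noncomputable def bobJoint (X : Ensemble ι n) (A : Attack n e) (M : POVM β n)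
    (i : ι) (b : β) : ℝ :=
  X.prob i * (A.output (X.state i) * (M.effect b ⊗ₖ (1 : Matrix e e ℂ))).trace.re

/-- The joint distribution of the encoded label and of the outcome when Eve measures `Z` on her
apparatus. -/
noncomputable def eveJoint (X : Ensemble ι n) (A : Attack n e) (Z : POVM β e)
    (i : ι) (z : β) : ℝ :=
  X.prob i * (A.output (X.state i) * ((1 : Matrix n n ℂ) ⊗ₖ Z.effect z)).trace.re

/-- The Shannon entropy, with logarithms to the base `r`, of a distribution on a finite set. -/
noncomputable def entropy {α : Type*} [Fintype α] (r : ℝ) (P : α → ℝ) : ℝ :=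
  -∑ a, P a * Real.logb r (P a)

/-- The mutual information `H(X) + H(Y) - H(X, Y)` of a joint distribution. -/
noncomputable def mutualInfo {α γ : Type*} [Fintype α] [Fintype γ] (r : ℝ) (P : α → γ → ℝ) : ℝ :=
  entropy r (fun a => ∑ c, P a c) + entropy r (fun c => ∑ a, P a c)
    - entropy r (fun x : α × γ => P x.1 x.2)

/-- The information gains of Bob on the label of `X`, over all his POVMs with finitely many
outcomes. -/
def bobGains (r : ℝ) (X : Ensemble ι n) (A : Attack n e) : Set ℝ :=
  {t | ∃ (m : ℕ) (M : POVM (Fin m) n), t = mutualInfo r (bobJoint X A M)}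

/-- The information gains of Eve on the label of `X`, over all her POVMs with finitely many
outcomes. -/
def eveGains (r : ℝ) (X : Ensemble ι n) (A : Attack n e) : Set ℝ :=
  {t | ∃ (m : ℕ) (Z : POVM (Fin m) e), t = mutualInfo r (eveJoint X A Z)}

/-- Bob's optimal information gain `I(X:B)`. -/
noncomputable def infoBob (r : ℝ) (X : Ensemble ι n) (A : Attack n e) : ℝ :=
  sSup (bobGains r X A)

/-- Eve's optimal information gain `I(X:E)`. -/
noncomputable def infoEve (r : ℝ) (X : Ensemble ι n) (A : Attack n e) : ℝ :=
  sSup (eveGains r X A)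

/-- The transpose of the operator `T` with respect to the orthonormal basis that the columns of
the unitary matrix `V` form. -/
def transposeIn (V T : Matrix n n ℂ) : Matrix n n ℂ :=
  V * (Vᴴ * T * V)ᵀ * Vᴴ

/-- The operators `pᵢ ρ^{-1/2} ᵗρᵢ ρ^{-1/2}` of the POVM that remotely prepares the ensemble `X`,
where `ρ` is the average state of `X` and the transpose is taken in the basis of the columns
of `V`. -/
noncomputable def prepOp (V : Matrix n n ℂ) (X : Ensemble ι n) (i : ι) : Matrix n n ℂ :=
  (X.prob i : ℂ) •
    ((CFC.sqrt X.average)⁻¹ * transposeIn V (X.state i) * (CFC.sqrt X.average)⁻¹)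

/-- The operator norm of a matrix acting on the Hilbert space `ℂⁿ`. -/
noncomputable def opNorm (T : Matrix n n ℂ) : ℝ :=
  ‖Matrix.toEuclideanCLM (𝕜 := ℂ) T‖

/-- The overlap `max_{i,k} ‖F_i^{1/2} G_k^{1/2}‖` of two finite families of positive operators. -/
noncomputable def overlap {κ : Type*} (F : ι → Matrix n n ℂ) (G : κ → Matrix n n ℂ) : ℝ :=
  ⨆ x : ι × κ, opNorm (CFC.sqrt (F x.1) * CFC.sqrt (G x.2))

end Information

end QInfo

/-! Both encodings are remote preparations from one source. If Alice shares a purification of ρ,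
then measuring the POVM `prepOp V X` or `prepOp V Y` on her half prepares the ensemble X or Y; both
are POVMs because ρ is fixed by the transpose in its eigenbasis. Bob and Eve hold separate factors,
so their outcomes b and z exist jointly, whatever Alice measures. Their effect, pulled back through
the attack and steered to Alice, leaves her with one family of unnormalized states ω b z, and
`trace_steer_mul_prepOp` recovers the joint distributions of either encoding from it.

Since I = H(label) - H(label | outcome), the claim becomes an uncertainty relation with two
classical memories: H(F | b) + H(G | z) ≥ -2 log c, where c is the overlap (`condLogSum_add_le`).
Its proof is of Riesz-Thorin type. Conditional probabilities x and y are inserted as the weights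
x^(s/2) y^(s/2) into a sum of inner products ⟨F_i ψ, G_k ψ⟩. This function of s is 1 at s = 0, at
most 1 in norm on the imaginary axis, and at most c on Re s = 1; the three lines theorem bounds its
derivative at 0, which is half the sum of the two negated conditional entropies. -/

namespace QInfo

/-! ### Differentiating the three lines theorem at an endpoint -/

/-- If an exponential sum `∑ tⱼ exp (aⱼ s)` has value `1` at `0`, is bounded by `1` on the imaginary
axis and by `c` on the line `re s = 1`, then its derivative at `0` has real part at most `log c`. -/
lemma sum_mul_re_le_log {J : Type*} [Fintype J] (a : J → ℝ) (t : J → ℂ) {c : ℝ} (hc : 0 < c)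
    (ht : ∑ j, t j = 1)
    (h0 : ∀ s : ℂ, s.re = 0 → ‖∑ j, Complex.exp (a j * s) * t j‖ ≤ 1)
    (h1 : ∀ s : ℂ, s.re = 1 → ‖∑ j, Complex.exp (a j * s) * t j‖ ≤ c) :
    ∑ j, a j * (t j).re ≤ Real.log c := by
  set f : ℂ → ℂ := fun s => ∑ j, Complex.exp (a j * s) * t j with hf
  have hdiff : Differentiable ℂ f := by
    rw [hf]; fun_prop
  have hbdd : BddAbove ((norm ∘ f) '' Complex.HadamardThreeLines.verticalClosedStrip 0 1) := by
    refine ⟨∑ j, Real.exp |a j| * ‖t j‖, ?_⟩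
    rintro _ ⟨s, hs, rfl⟩
    refine (norm_sum_le _ _).trans (Finset.sum_le_sum fun j _ => ?_)
    rw [norm_mul, Complex.norm_exp]
    gcongr
    have hs' : s.re ∈ Set.Icc (0 : ℝ) 1 := hs
    have : ((a j : ℂ) * s).re = a j * s.re := by simp
    rw [this]
    calc a j * s.re ≤ |a j| * s.re := by gcongr; exacts [hs'.1, le_abs_self _]
      _ ≤ |a j| := mul_le_of_le_one_right (abs_nonneg _) hs'.2
  have key : ∀ x : ℝ, x ∈ Set.Icc (0 : ℝ) 1 → (f x).re ≤ c ^ x := by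
    intro x hx
    have hz : (x : ℂ) ∈ Complex.HadamardThreeLines.verticalClosedStrip 0 1 := by
      simpa [Complex.HadamardThreeLines.verticalClosedStrip] using hx
    have := Complex.HadamardThreeLines.norm_le_interp_of_mem_verticalClosedStrip₀₁' f hz
      hdiff.diffContOnCl hbdd (a := 1) (b := c) h0 h1
    simp only [Complex.ofReal_re, Real.one_rpow, one_mul] at this
    exact (Complex.re_le_norm _).trans this
  -- By the three lines bound, `g` is nonnegative on [0, 1] and vanishes at 0, so its right
  -- derivative at 0 cannot be negative.
  set g : ℝ → ℝ := fun x => c ^ x - ∑ j, Real.exp (a j * x) * (t j).re with hg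
  have hfg : ∀ x : ℝ, (f x).re = ∑ j, Real.exp (a j * x) * (t j).re := by
    intro x
    simp only [hf, Complex.re_sum]
    refine Finset.sum_congr rfl fun j _ => ?_
    rw [← Complex.ofReal_mul, ← Complex.ofReal_exp, Complex.re_ofReal_mul]
  have hg0 : g 0 = 0 := by
    have : ∑ j, (t j).re = 1 := by rw [← Complex.re_sum, ht, Complex.one_re]
    simp [hg, this]
  have hder : HasDerivAt g (Real.log c - ∑ j, a j * (t j).re) 0 := by
    refine HasDerivAt.sub ?_ (HasDerivAt.fun_sum fun j _ => ?_)
    · simpa using Real.hasStrictDerivAt_const_rpow hc 0 |>.hasDerivAt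
    · simpa using (((hasDerivAt_id (0 : ℝ)).const_mul (a j)).exp).mul_const (t j).re
  have hlim := (hasDerivWithinAt_iff_tendsto_slope' Set.self_notMem_Ioi).1
    (hder.hasDerivWithinAt (s := Set.Ioi 0))
  have := ge_of_tendsto hlim (b := 0) (by
    filter_upwards [Ioo_mem_nhdsGT (zero_lt_one' ℝ)] with x hx
    rw [slope_def_field, hg0, sub_zero, sub_zero]
    refine div_nonneg ?_ hx.1.le
    have := key x ⟨hx.1.le, hx.2.le⟩
    rw [hfg] at this
    simp only [hg]; linarith)
  linarith

/-! ### Uncertainty relation for square roots of POVMs -/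

section Resolution

variable {E ι : Type*} [NormedAddCommGroup E] [InnerProductSpace ℂ E] [Fintype ι]
  {S : ι → E →L[ℂ] E}

/-- A family of symmetric operators whose squares sum to the identity. -/
structure IsSqrtResolution (S : ι → E →L[ℂ] E) : Prop where
  symm : ∀ i u v, inner ℂ (S i u) v = inner ℂ u (S i v)
  sum_sq : ∀ v, ∑ i, S i (S i v) = v

lemma IsSqrtResolution.sum_norm_sq (hS : IsSqrtResolution S) (v : E) :
    ∑ i, ‖S i v‖ ^ 2 = ‖v‖ ^ 2 := by
  have h : ∑ i, (inner ℂ (S i v) (S i v) : ℂ) = inner ℂ v v := by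
    simp_rw [hS.symm, ← inner_sum, hS.sum_sq]
  simp_rw [inner_self_eq_norm_sq_to_K] at h
  exact_mod_cast h

/-- The map `v ↦ (S i v)` into the direct sum is an isometry, so its adjoint is a contraction. -/
lemma IsSqrtResolution.norm_sum_le (hS : IsSqrtResolution S) (u : ι → E) :
    ‖∑ i, S i (u i)‖ ≤ √(∑ i, ‖u i‖ ^ 2) := by
  set y := ∑ i, S i (u i) with hy
  have h1 : ‖y‖ ^ 2 ≤ ∑ i, ‖S i y‖ * ‖u i‖ := by
    have : (inner ℂ y y : ℂ) = ∑ i, inner ℂ (S i y) (u i) := by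
      conv_lhs => rw [hy, inner_sum]
      exact Finset.sum_congr rfl fun i _ => (hS.symm i _ _).symm
    calc ‖y‖ ^ 2 = ‖(inner ℂ y y : ℂ)‖ := by
          rw [inner_self_eq_norm_sq_to_K, norm_pow]; simp
      _ ≤ _ := by
          rw [this]
          exact (_root_.norm_sum_le _ _).trans (Finset.sum_le_sum fun i _ => norm_inner_le_norm _ _)
  have h2 := Real.sum_mul_le_sqrt_mul_sqrt Finset.univ (fun i => ‖S i y‖) fun i => ‖u i‖
  rw [hS.sum_norm_sq, Real.sqrt_sq (norm_nonneg _)] at h2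
  rcases (norm_nonneg y).eq_or_lt with h | h
  · rw [← h]; exact Real.sqrt_nonneg _
  · exact le_of_mul_le_mul_left (by nlinarith) h

/-- Phases do not change the norms of the components `S i v`. This gives the bound on the imaginary
axis. -/
lemma IsSqrtResolution.norm_sum_smul_le (hS : IsSqrtResolution S) (a : ι → ℂ)
    (ha : ∀ i, ‖a i‖ = 1) (v : E) : ‖∑ i, a i • S i (S i v)‖ ≤ ‖v‖ := by
  have h := hS.norm_sum_le fun i => a i • S i v
  simp_rw [map_smul, norm_smul, ha, one_mul, hS.sum_norm_sq] at h
  rwa [Real.sqrt_sq (norm_nonneg _)] at h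

/-- Cauchy-Schwarz with the coefficients √(x i). Where `x i = 0`, the convention `Real.log 0 = 0`
makes the exponential 1 instead of 0; `hv` removes these terms. -/
lemma IsSqrtResolution.sum_exp_log_mul_norm_le (hS : IsSqrtResolution S) (x : ι → ℝ)
    (hx : ∀ i, 0 ≤ x i) (hx1 : ∑ i, x i ≤ 1) (v : E) (hv : ∀ i, x i = 0 → S i v = 0) :
    ∑ i, Real.exp (Real.log (x i) / 2) * ‖S i v‖ ≤ ‖v‖ := by
  calc ∑ i, Real.exp (Real.log (x i) / 2) * ‖S i v‖ = ∑ i, √(x i) * ‖S i v‖ := by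
        refine Finset.sum_congr rfl fun i _ => ?_
        rcases (hx i).eq_or_lt with h | h
        · rw [hv i h.symm]; simp
        · rw [Real.exp_half, Real.exp_log h]
    _ ≤ √(∑ i, √(x i) ^ 2) * √(∑ i, ‖S i v‖ ^ 2) := Real.sum_mul_le_sqrt_mul_sqrt _ _ _
    _ ≤ 1 * ‖v‖ := by
        rw [hS.sum_norm_sq, Real.sqrt_sq (norm_nonneg _)]
        gcongr
        rw [Real.sqrt_le_one]
        simpa only [Real.sq_sqrt (hx _)] using hx1
    _ = ‖v‖ := one_mul _

/-- One factor `S i` is moved across, so that the overlap `S i ∘L T k` appears between `S i v` and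
`T k v`. This is where `c` enters on the line Re s = 1. -/
lemma IsSqrtResolution.norm_inner_sq_le {κ : Type*} {T : κ → E →L[ℂ] E} (hS : IsSqrtResolution S) {c : ℝ}
    (hc : ∀ i k, ‖S i ∘L T k‖ ≤ c) (i : ι) (k : κ) (v : E) :
    ‖(inner ℂ (S i (S i v)) (T k (T k v)) : ℂ)‖ ≤ c * (‖S i v‖ * ‖T k v‖) := by
  rw [hS.symm]
  refine (norm_inner_le_norm _ _).trans ?_
  have := ((S i ∘L T k).le_opNorm (T k v)).trans
    (mul_le_mul_of_nonneg_right (hc i k) (norm_nonneg _))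
  calc ‖S i v‖ * ‖S i (T k (T k v))‖ ≤ ‖S i v‖ * (c * ‖T k v‖) :=
        mul_le_mul_of_nonneg_left this (norm_nonneg _)
    _ = _ := by ring

variable {κ W : Type*} [Fintype κ] [Fintype W] {T : κ → E →L[ℂ] E}

/-- Otherwise every `S i ∘L T k` vanishes, and summing over both resolutions kills `v`. Positivity
is needed for `c ^ x` and `log c`. -/
lemma pos_of_norm_comp_le (hS : IsSqrtResolution S) (hT : IsSqrtResolution T) {c : ℝ}
    (hc : ∀ i k, ‖S i ∘L T k‖ ≤ c) {v : E} (hv : v ≠ 0) : 0 < c := by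
  by_contra! h
  have h0 : ∀ i k u, S i (T k u) = 0 := fun i k u => by
    have h1 : S i ∘L T k = 0 := norm_le_zero_iff.1 ((hc i k).trans h)
    simpa using congrArg (fun R : E →L[ℂ] E => R u) h1
  refine hv ?_
  have h1 : ∀ i, S i v = 0 := fun i => by
    rw [← hT.sum_sq v, map_sum]
    exact Finset.sum_eq_zero fun k _ => h0 i k _
  rw [← hS.sum_sq v]
  simp [h1]

/-- The entropic uncertainty relation for guesses `x` and `y` of the outcomes of two measurements
that are made on the vectors `ψ w`; each guess may depend on `w`. -/
lemma sum_norm_sq_mul_log_le (hS : IsSqrtResolution S) (hT : IsSqrtResolution T) {c : ℝ}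
    (hc : ∀ i k, ‖S i ∘L T k‖ ≤ c) (ψ : W → E) (hψ : ∑ w, ‖ψ w‖ ^ 2 = 1)
    (x : W → ι → ℝ) (hx : ∀ w i, 0 ≤ x w i) (hx1 : ∀ w, ∑ i, x w i ≤ 1)
    (hxψ : ∀ w i, x w i = 0 → S i (ψ w) = 0)
    (y : W → κ → ℝ) (hy : ∀ w k, 0 ≤ y w k) (hy1 : ∀ w, ∑ k, y w k ≤ 1)
    (hyψ : ∀ w k, y w k = 0 → T k (ψ w) = 0) :
    ∑ w, ∑ i, ‖S i (ψ w)‖ ^ 2 * Real.log (x w i) + ∑ w, ∑ k, ‖T k (ψ w)‖ ^ 2 * Real.log (y w k)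
      ≤ 2 * Real.log c := by
  have hc0 : 0 < c := by
    obtain ⟨w, hw⟩ : ∃ w, ψ w ≠ 0 := by
      by_contra! h
      simp [h] at hψ
    exact pos_of_norm_comp_le hS hT hc hw
  set t : W × ι × κ → ℂ := fun p =>
    inner ℂ (S p.2.1 (S p.2.1 (ψ p.1))) (T p.2.2 (T p.2.2 (ψ p.1))) with ht
  -- The halves make the weights on Re s = 1 equal to √x and √y, the right size for Cauchy-Schwarz;
  -- they are also the source of the factor 2 in the result.
  set a : W × ι × κ → ℝ := fun p =>
    Real.log (x p.1 p.2.1) / 2 + Real.log (y p.1 p.2.2) / 2 with ha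
  have hsumT : ∀ w i, ∑ k, t (w, i, k) = (‖S i (ψ w)‖ ^ 2 : ℝ) := by
    intro w i
    simp only [ht]
    rw [← inner_sum, hT.sum_sq, hS.symm, inner_self_eq_norm_sq_to_K]
    simp
  have hsumS : ∀ w k, ∑ i, t (w, i, k) = (‖T k (ψ w)‖ ^ 2 : ℝ) := by
    intro w k
    simp only [ht]
    rw [← sum_inner, hS.sum_sq, ← hT.symm, inner_self_eq_norm_sq_to_K]
    simp
  have h := sum_mul_re_le_log a t hc0 ?_ ?_ ?_
  · have hsplit : ∑ p, a p * (t p).re = (∑ w, ∑ i, ‖S i (ψ w)‖ ^ 2 * Real.log (x w i)) / 2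
        + (∑ w, ∑ k, ‖T k (ψ w)‖ ^ 2 * Real.log (y w k)) / 2 := by
      simp_rw [Fintype.sum_prod_type, Finset.sum_div, ← Finset.sum_add_distrib]
      refine Finset.sum_congr rfl fun w _ => ?_
      simp only [ha, add_mul, Finset.sum_add_distrib]
      congr 1
      · refine Finset.sum_congr rfl fun i _ => ?_
        rw [← Finset.mul_sum, ← Complex.re_sum, hsumT, Complex.ofReal_re]
        ring
      · rw [Finset.sum_comm]
        refine Finset.sum_congr rfl fun k _ => ?_
        rw [← Finset.mul_sum, ← Complex.re_sum, hsumS, Complex.ofReal_re]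
        ring
    linarith
  · simp_rw [Fintype.sum_prod_type, hsumT, ← Complex.ofReal_sum, hS.sum_norm_sq, hψ,
      Complex.ofReal_one]
  · intro s hs
    simp_rw [Fintype.sum_prod_type]
    calc _ ≤ ∑ w, ‖ψ w‖ ^ 2 := (norm_sum_le _ _).trans (Finset.sum_le_sum fun w _ => ?_)
      _ = 1 := hψ
    have hexp : ∀ b : ℝ, ‖Complex.exp (b * s)‖ = 1 := fun b => by
      rw [Complex.norm_exp, Complex.re_ofReal_mul, hs, mul_zero, Real.exp_zero]
    -- The weight of (i, k) is a product, so the double sum is a single inner product. The left slot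
    -- is conjugate linear, hence the conjugated phases.
    have : ∑ i, ∑ k, Complex.exp (a (w, i, k) * s) * t (w, i, k)
        = inner ℂ
          (∑ i, (starRingEnd ℂ) (Complex.exp ((Real.log (x w i) / 2 : ℝ) * s))
            • S i (S i (ψ w)))
          (∑ k, Complex.exp ((Real.log (y w k) / 2 : ℝ) * s) • T k (T k (ψ w))) := by
      simp_rw [sum_inner, inner_sum, inner_smul_left, inner_smul_right, Complex.conj_conj, ha,
        Complex.ofReal_add, add_mul, Complex.exp_add, ht, mul_assoc]
    rw [this, sq]
    refine (norm_inner_le_norm _ _).trans (mul_le_mul ?_ ?_ (norm_nonneg _) (norm_nonneg _))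
    · exact hS.norm_sum_smul_le _ (fun i => by rw [RCLike.norm_conj, hexp]) _
    · exact hT.norm_sum_smul_le _ (fun k => hexp _) _
  · intro s hs
    simp_rw [Fintype.sum_prod_type]
    calc _ ≤ ∑ w, c * ‖ψ w‖ ^ 2 := (norm_sum_le _ _).trans (Finset.sum_le_sum fun w _ => ?_)
      _ = c := by rw [← Finset.mul_sum, hψ, mul_one]
    calc _ ≤ ∑ i, ∑ k, c * ((Real.exp (Real.log (x w i) / 2) * ‖S i (ψ w)‖) *
            (Real.exp (Real.log (y w k) / 2) * ‖T k (ψ w)‖)) := by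
          refine (norm_sum_le _ _).trans (Finset.sum_le_sum fun i _ => ?_)
          refine (norm_sum_le _ _).trans (Finset.sum_le_sum fun k _ => ?_)
          rw [norm_mul, Complex.norm_exp, Complex.re_ofReal_mul, hs, mul_one]
          simp only [ha, Real.exp_add]
          refine (mul_le_mul_of_nonneg_left (hS.norm_inner_sq_le hc i k (ψ w))
            (by positivity)).trans_eq (by ring)
      _ = c * ((∑ i, Real.exp (Real.log (x w i) / 2) * ‖S i (ψ w)‖) *
            ∑ k, Real.exp (Real.log (y w k) / 2) * ‖T k (ψ w)‖) := by
          rw [Finset.sum_mul_sum]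
          simp_rw [Finset.mul_sum]
      _ ≤ c * ‖ψ w‖ ^ 2 := by
          rw [sq]
          gcongr
          · exact hS.sum_exp_log_mul_norm_le _ (hx w) (hx1 w) _ (hxψ w)
          · exact hT.sum_exp_log_mul_norm_le _ (hy w) (hy1 w) _ (hyψ w)

end Resolution

/-! ### Mutual information and conditional entropy -/

section Entropy

variable {ι β : Type*} [Fintype ι] [Fintype β]

/-- Minus the conditional entropy, in natural units, of the first variable given the second. -/
noncomputable def condLogSum (J : ι → β → ℝ) : ℝ :=
  ∑ i, ∑ b, J i b * Real.log (J i b / ∑ i', J i' b)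

lemma mutualInfo_eq (r : ℝ) (J : ι → β → ℝ) (hJ : ∀ i b, 0 ≤ J i b) :
    mutualInfo r J = entropy r (fun i => ∑ b, J i b) + condLogSum J / Real.log r := by
  have h : condLogSum J = (∑ i, ∑ b, J i b * Real.log (J i b))
      - ∑ b, (∑ i, J i b) * Real.log (∑ i, J i b) := by
    simp only [condLogSum]
    rw [eq_sub_iff_add_eq]
    simp_rw [Finset.sum_mul]
    rw [Finset.sum_comm (s := (Finset.univ : Finset β)), ← Finset.sum_add_distrib]
    refine Finset.sum_congr rfl fun i _ => ?_
    rw [← Finset.sum_add_distrib]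
    refine Finset.sum_congr rfl fun b _ => ?_
    rcases (hJ i b).eq_or_lt with h0 | h0
    · simp [← h0]
    · have h1 : 0 < ∑ i', J i' b :=
        h0.trans_le (Finset.single_le_sum (fun i' _ => hJ i' b) (Finset.mem_univ i))
      rw [Real.log_div h0.ne' h1.ne']
      ring
  rw [mutualInfo, h]
  simp only [entropy, Real.logb, Fintype.sum_prod_type, sub_div, Finset.sum_div, mul_div_assoc]
  ring

end Entropy

/-! ### From vectors to states: uncertainty with two memories -/

section Matrices

variable {ι κ β γ n e : Type*} [Fintype ι] [Fintype κ] [Fintype β] [Fintype γ] [Fintype n]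
  [Fintype e] [DecidableEq n] [DecidableEq e]

lemma posSemidef_sqrt (A : Matrix n n ℂ) : (CFC.sqrt A).PosSemidef :=
  Matrix.nonneg_iff_posSemidef.1 (CFC.sqrt_nonneg A)

lemma trace_mul_re_nonneg {A B : Matrix n n ℂ} (hA : A.PosSemidef) (hB : B.PosSemidef) :
    0 ≤ (A * B).trace.re := by
  have h : A = CFC.sqrt A * CFC.sqrt A := (CFC.sqrt_mul_sqrt_self A hA.nonneg).symm
  have hs : (CFC.sqrt A).PosSemidef := posSemidef_sqrt A
  rw [h, mul_assoc, Matrix.trace_mul_comm]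
  have := (hB.mul_mul_conjTranspose_same (CFC.sqrt A)).trace_nonneg
  rw [hs.isHermitian.eq] at this
  exact (Complex.le_def.1 this).1

/-- `D * Dᴴ` is the sum of the rank-one operators of the columns of `D`. -/
lemma sum_norm_sq_col (S D : Matrix n n ℂ) :
    ∑ j, ‖Matrix.toEuclideanCLM (𝕜 := ℂ) S (WithLp.toLp 2 (fun i => D i j))‖ ^ 2
      = ((D * Dᴴ) * (Sᴴ * S)).trace.re := by
  have h : (D * Dᴴ) * (Sᴴ * S) = D * ((S * D)ᴴ * S) := by
    rw [Matrix.conjTranspose_mul]; simp only [mul_assoc]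
  rw [h, Matrix.trace_mul_comm, mul_assoc]
  simp only [Matrix.trace, Matrix.diag, Complex.re_sum, Matrix.mul_apply (M := (S * D)ᴴ)]
  refine Finset.sum_congr rfl fun j _ => ?_
  rw [Matrix.toEuclideanCLM_toLp, EuclideanSpace.norm_sq_eq]
  refine Finset.sum_congr rfl fun i _ => ?_
  have : (S *ᵥ fun i => D i j) i = (S * D) i j := rfl
  simp only [this, Matrix.conjTranspose_apply]
  rw [Complex.star_def, ← Complex.normSq_eq_conj_mul_self, Complex.ofReal_re,
    Complex.normSq_eq_norm_sq]

lemma POVM.isSqrtResolution (F : POVM ι n) :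
    IsSqrtResolution fun i => Matrix.toEuclideanCLM (𝕜 := ℂ) (CFC.sqrt (F.effect i)) where
  symm i u v := by
    have hs : (CFC.sqrt (F.effect i)).PosSemidef := posSemidef_sqrt _
    have h : star (Matrix.toEuclideanCLM (𝕜 := ℂ) (CFC.sqrt (F.effect i)))
        = Matrix.toEuclideanCLM (𝕜 := ℂ) (CFC.sqrt (F.effect i)) := by
      rw [← map_star, Matrix.star_eq_conjTranspose, hs.isHermitian.eq]
    rw [← ContinuousLinearMap.adjoint_inner_right, ← ContinuousLinearMap.star_eq_adjoint, h]
  sum_sq v := by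
    have h : ∀ i, Matrix.toEuclideanCLM (𝕜 := ℂ) (CFC.sqrt (F.effect i))
        (Matrix.toEuclideanCLM (𝕜 := ℂ) (CFC.sqrt (F.effect i)) v)
        = Matrix.toEuclideanCLM (𝕜 := ℂ) (F.effect i) v := fun i => by
      rw [← mul_apply_eq_comp, ← map_mul,
        CFC.sqrt_mul_sqrt_self _ (F.effect_posSemidef i).nonneg]
    simp_rw [h]
    rw [← sum_apply, ← map_sum, F.sum_effect, map_one]
    rfl

lemma norm_comp_le_overlap (F : ι → Matrix n n ℂ) (G : κ → Matrix n n ℂ) (i : ι) (k : κ) :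
    ‖Matrix.toEuclideanCLM (𝕜 := ℂ) (CFC.sqrt (F i)) ∘L
      Matrix.toEuclideanCLM (𝕜 := ℂ) (CFC.sqrt (G k))‖ ≤ overlap F G := by
  have h : Matrix.toEuclideanCLM (𝕜 := ℂ) (CFC.sqrt (F i)) ∘L
      Matrix.toEuclideanCLM (𝕜 := ℂ) (CFC.sqrt (G k))
      = Matrix.toEuclideanCLM (𝕜 := ℂ) (CFC.sqrt (F i) * CFC.sqrt (G k)) := by
    rw [map_mul]; rfl
  rw [h]
  exact le_ciSup (f := fun x : ι × κ => opNorm (CFC.sqrt (F x.1) * CFC.sqrt (G x.2)))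
    (Set.finite_range _).bddAbove (i, k)

/-- Statistical weights of the outcome `i` of `F` on the columns of the square root of `ω`. -/
lemma POVM.sum_norm_sq_sqrt_col (F : POVM ι n) {ω : Matrix n n ℂ} (hω : ω.PosSemidef) (i : ι) :
    ∑ j, ‖Matrix.toEuclideanCLM (𝕜 := ℂ) (CFC.sqrt (F.effect i))
        (WithLp.toLp 2 (fun l => CFC.sqrt ω l j))‖ ^ 2 = (ω * F.effect i).trace.re := by
  rw [sum_norm_sq_col, (posSemidef_sqrt ω).isHermitian.eq,
    (posSemidef_sqrt (F.effect i)).isHermitian.eq,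
    CFC.sqrt_mul_sqrt_self _ (F.effect_posSemidef i).nonneg, CFC.sqrt_mul_sqrt_self _ hω.nonneg]

/-- Only an inequality, since the quotients are all 0 when the total is 0. -/
lemma sum_div_sum_le_one {α : Type*} [Fintype α] (f : α → ℝ) : ∑ i, f i / ∑ i', f i' ≤ 1 := by
  rw [← Finset.sum_div]
  exact div_self_le_one _

lemma eq_zero_of_div_sum_eq_zero {α : Type*} [Fintype α] {f : α → ℝ} (hf : ∀ i, 0 ≤ f i) {i : α}
    (h : f i / ∑ i', f i' = 0) : f i = 0 := by
  rcases div_eq_zero_iff.1 h with h | h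
  · exact h
  · exact (Finset.sum_eq_zero_iff_of_nonneg fun i _ => hf i).1 h i (Finset.mem_univ i)

/-- The entropic uncertainty relation for two POVMs, with two parties that hold the classical
memories `b` and `z` about a state which is `ω b z`, normalized, given these memories. -/
lemma condLogSum_add_le (F : POVM ι n) (G : POVM κ n) (ω : β → γ → Matrix n n ℂ)
    (hω : ∀ b z, (ω b z).PosSemidef) (hω1 : ∑ b, ∑ z, (ω b z).trace.re = 1)
    (J : ι → β → ℝ) (hJ : ∀ i b, J i b = ∑ z, (ω b z * F.effect i).trace.re)
    (L : κ → γ → ℝ) (hL : ∀ k z, L k z = ∑ b, (ω b z * G.effect k).trace.re) :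
    condLogSum J + condLogSum L ≤ 2 * Real.log (overlap F.effect G.effect) := by
  have hP : ∀ i b z, 0 ≤ (ω b z * F.effect i).trace.re := fun i b z =>
    trace_mul_re_nonneg (hω b z) (F.effect_posSemidef i)
  have hQ : ∀ k b z, 0 ≤ (ω b z * G.effect k).trace.re := fun k b z =>
    trace_mul_re_nonneg (hω b z) (G.effect_posSemidef k)
  have hJ0 : ∀ i b, 0 ≤ J i b := fun i b => hJ i b ▸ Finset.sum_nonneg fun z _ => hP i b z
  have hL0 : ∀ k z, 0 ≤ L k z := fun k z => hL k z ▸ Finset.sum_nonneg fun b _ => hQ k b z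
  let S : ι → EuclideanSpace ℂ n →L[ℂ] EuclideanSpace ℂ n :=
    fun i => Matrix.toEuclideanCLM (𝕜 := ℂ) (CFC.sqrt (F.effect i))
  let T : κ → EuclideanSpace ℂ n →L[ℂ] EuclideanSpace ℂ n :=
    fun k => Matrix.toEuclideanCLM (𝕜 := ℂ) (CFC.sqrt (G.effect k))
  -- The columns of √(ω b z) decompose ω b z into vectors, which reduces mixed states to the vector
  -- case.
  let ψ : β × γ × n → EuclideanSpace ℂ n :=
    fun w => WithLp.toLp 2 fun l => CFC.sqrt (ω w.1 w.2.1) l w.2.2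
  have hS : ∀ i b z, ∑ j, ‖S i (ψ (b, z, j))‖ ^ 2 = (ω b z * F.effect i).trace.re :=
    fun i b z => F.sum_norm_sq_sqrt_col (hω b z) i
  have hT : ∀ k b z, ∑ j, ‖T k (ψ (b, z, j))‖ ^ 2 = (ω b z * G.effect k).trace.re :=
    fun k b z => G.sum_norm_sq_sqrt_col (hω b z) k
  have hS0 : ∀ i b z, J i b = 0 → ∀ j, S i (ψ (b, z, j)) = 0 := by
    intro i b z h j
    rw [hJ] at h
    have h1 := (Finset.sum_eq_zero_iff_of_nonneg fun z _ => hP i b z).1 h z (Finset.mem_univ z)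
    rw [← hS] at h1
    have h2 := (Finset.sum_eq_zero_iff_of_nonneg fun j _ => sq_nonneg _).1 h1 j
      (Finset.mem_univ j)
    simpa using h2
  have hT0 : ∀ k b z, L k z = 0 → ∀ j, T k (ψ (b, z, j)) = 0 := by
    intro k b z h j
    rw [hL] at h
    have h1 := (Finset.sum_eq_zero_iff_of_nonneg fun b _ => hQ k b z).1 h b (Finset.mem_univ b)
    rw [← hT] at h1
    have h2 := (Finset.sum_eq_zero_iff_of_nonneg fun j _ => sq_nonneg _).1 h1 j
      (Finset.mem_univ j)
    simpa using h2
  have hψ : ∑ w, ‖ψ w‖ ^ 2 = 1 := by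
    rw [← hω1]
    simp_rw [Fintype.sum_prod_type]
    refine Finset.sum_congr rfl fun b _ => Finset.sum_congr rfl fun z _ => ?_
    rw [Finset.sum_congr rfl fun j _ => (F.isSqrtResolution.sum_norm_sq (ψ (b, z, j))).symm,
      Finset.sum_comm]
    refine (Finset.sum_congr rfl fun i _ => hS i b z).trans ?_
    rw [← Complex.re_sum, ← Matrix.trace_sum, ← Finset.mul_sum, F.sum_effect, mul_one]
  -- The guesses are the conditional probabilities: that of i uses only b, that of k only z, and
  -- neither uses the column index. Summing out the unused indices then yields `J` and `L`.
  have h := sum_norm_sq_mul_log_le F.isSqrtResolution G.isSqrtResolution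
    (norm_comp_le_overlap F.effect G.effect) ψ hψ
    (fun w i => J i w.1 / ∑ i', J i' w.1)
    (fun w i => div_nonneg (hJ0 i _) (Finset.sum_nonneg fun i _ => hJ0 i _))
    (fun w => sum_div_sum_le_one fun i => J i w.1)
    (fun w i h => hS0 i w.1 w.2.1 (eq_zero_of_div_sum_eq_zero (fun i => hJ0 i w.1) h) w.2.2)
    (fun w k => L k w.2.1 / ∑ k', L k' w.2.1)
    (fun w k => div_nonneg (hL0 k _) (Finset.sum_nonneg fun k _ => hL0 k _))
    (fun w => sum_div_sum_le_one fun k => L k w.2.1)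
    (fun w k h => hT0 k w.1 w.2.1 (eq_zero_of_div_sum_eq_zero (fun k => hL0 k w.2.1) h) w.2.2)
  refine le_trans (le_of_eq ?_) h
  congr 1
  · rw [condLogSum, Finset.sum_comm (s := (Finset.univ : Finset (β × γ × n)))]
    refine Finset.sum_congr rfl fun i _ => ?_
    simp_rw [Fintype.sum_prod_type]
    refine Finset.sum_congr rfl fun b _ => ?_
    simp_rw [← Finset.sum_mul]
    congr 1
    rw [hJ]
    exact Finset.sum_congr rfl fun z _ => (hS i b z).symm
  · rw [condLogSum, Finset.sum_comm (s := (Finset.univ : Finset (β × γ × n)))]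
    refine Finset.sum_congr rfl fun k _ => ?_
    simp_rw [Fintype.sum_prod_type]
    rw [Finset.sum_comm (s := (Finset.univ : Finset β))]
    refine Finset.sum_congr rfl fun z _ => ?_
    simp_rw [← Finset.sum_mul]
    congr 1
    rw [hL]
    exact Finset.sum_congr rfl fun b _ => (hT k b z).symm

end Matrices

/-! ### Transposition in an orthonormal basis -/

section Transpose

variable {n : Type*} [Fintype n] {V : Matrix n n ℂ}

lemma transposeIn_posSemidef {T : Matrix n n ℂ} (hT : T.PosSemidef) :
    (transposeIn V T).PosSemidef :=
  (hT.conjTranspose_mul_mul_same V).transpose.mul_mul_conjTranspose_same V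

lemma transposeIn_sum {α : Type*} (s : Finset α) (T : α → Matrix n n ℂ) :
    transposeIn V (∑ a ∈ s, T a) = ∑ a ∈ s, transposeIn V (T a) := by
  simp only [transposeIn, Finset.mul_sum, Finset.sum_mul, Matrix.transpose_sum]

lemma transposeIn_smul (c : ℂ) (T : Matrix n n ℂ) :
    transposeIn V (c • T) = c • transposeIn V T := by
  simp only [transposeIn, Matrix.mul_smul, Matrix.smul_mul, Matrix.transpose_smul]

variable [DecidableEq n]

lemma mul_conjTranspose_of_mem_unitaryGroup (hV : V ∈ Matrix.unitaryGroup n ℂ) : V * Vᴴ = 1 := by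
  rw [← Matrix.star_eq_conjTranspose]; exact Matrix.mem_unitaryGroup_iff.1 hV

lemma conjTranspose_mul_of_mem_unitaryGroup (hV : V ∈ Matrix.unitaryGroup n ℂ) : Vᴴ * V = 1 := by
  rw [← Matrix.star_eq_conjTranspose]; exact Matrix.mem_unitaryGroup_iff'.1 hV

lemma transposeIn_mul (hV : V ∈ Matrix.unitaryGroup n ℂ) (S T : Matrix n n ℂ) :
    transposeIn V (S * T) = transposeIn V T * transposeIn V S := by
  have h1 := mul_conjTranspose_of_mem_unitaryGroup hV
  have h2 := conjTranspose_mul_of_mem_unitaryGroup hV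
  have h : Vᴴ * (S * T) * V = (Vᴴ * S * V) * (Vᴴ * T * V) := by
    calc Vᴴ * (S * T) * V = Vᴴ * S * 1 * T * V := by simp only [mul_one, mul_assoc]
      _ = _ := by rw [← h1]; simp only [mul_assoc]
  rw [transposeIn, h, Matrix.transpose_mul, transposeIn, transposeIn]
  generalize (Vᴴ * S * V)ᵀ = s
  generalize (Vᴴ * T * V)ᵀ = t
  calc V * (t * s) * Vᴴ = V * t * 1 * s * Vᴴ := by simp only [mul_one, mul_assoc]
    _ = _ := by rw [← h2]; simp only [mul_assoc]

lemma trace_transposeIn (hV : V ∈ Matrix.unitaryGroup n ℂ) (T : Matrix n n ℂ) :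
    (transposeIn V T).trace = T.trace := by
  rw [transposeIn, Matrix.trace_mul_comm, ← mul_assoc,
    conjTranspose_mul_of_mem_unitaryGroup hV, one_mul, Matrix.trace_transpose,
    Matrix.trace_mul_comm, ← mul_assoc, mul_conjTranspose_of_mem_unitaryGroup hV, one_mul]

lemma transposeIn_one (hV : V ∈ Matrix.unitaryGroup n ℂ) : transposeIn V 1 = 1 := by
  rw [transposeIn, mul_one, conjTranspose_mul_of_mem_unitaryGroup hV, Matrix.transpose_one,
    mul_one, mul_conjTranspose_of_mem_unitaryGroup hV]

lemma transposeIn_diagonal (hV : V ∈ Matrix.unitaryGroup n ℂ) (d : n → ℂ) :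
    transposeIn V (V * Matrix.diagonal d * Vᴴ) = V * Matrix.diagonal d * Vᴴ := by
  have h2 := conjTranspose_mul_of_mem_unitaryGroup hV
  have h : Vᴴ * (V * Matrix.diagonal d * Vᴴ) * V = Matrix.diagonal d := by
    calc _ = (Vᴴ * V) * Matrix.diagonal d * (Vᴴ * V) := by simp only [mul_assoc]
      _ = _ := by rw [h2, one_mul, mul_one]
  rw [transposeIn, h, Matrix.diagonal_transpose]

end Transpose

/-! ### Invertibility of the square root of ρ -/

section Sqrt

variable {n : Type*} [Fintype n] [DecidableEq n] {ρ : Matrix n n ℂ}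

lemma isUnit_sqrt_det (hρ : ρ.PosDef) : IsUnit (CFC.sqrt ρ).det := by
  have h : IsUnit (CFC.sqrt ρ * CFC.sqrt ρ).det := by
    rw [CFC.sqrt_mul_sqrt_self _ hρ.posSemidef.nonneg]
    exact hρ.det_pos.ne'.isUnit
  rw [Matrix.det_mul] at h
  exact isUnit_of_mul_isUnit_left h

lemma sqrt_inv_mul_mul_sqrt_inv (hρ : ρ.PosDef) :
    (CFC.sqrt ρ)⁻¹ * ρ * (CFC.sqrt ρ)⁻¹ = 1 := by
  have h := isUnit_sqrt_det hρ
  have hsq := CFC.sqrt_mul_sqrt_self ρ hρ.posSemidef.nonneg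
  generalize CFC.sqrt ρ = R at h hsq
  rw [← hsq, ← mul_assoc, Matrix.nonsing_inv_mul _ h, one_mul, Matrix.mul_nonsing_inv _ h]

end Sqrt

/-! ### Remote preparation, steering and the attack in the Heisenberg picture -/

section Preparation

variable {ι n e : Type*} [Fintype ι] [Fintype n] [DecidableEq n] [Fintype e] [DecidableEq e]

/-- The POVM that remotely prepares the ensemble `X`. -/
noncomputable def prepPOVM (V : Matrix n n ℂ) (X : Ensemble ι n) (hρ : X.average.PosDef)
    (hfix : transposeIn V X.average = X.average) : POVM ι n where
  effect := prepOp V X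
  effect_posSemidef i := by
    have h := (transposeIn_posSemidef (V := V) (X.state_density i).1).mul_mul_conjTranspose_same
      (CFC.sqrt X.average)⁻¹
    rw [(posSemidef_sqrt X.average).isHermitian.inv.eq] at h
    exact h.smul (by exact_mod_cast X.prob_nonneg i)
  sum_effect := by
    have h : ∀ i, prepOp V X i = (CFC.sqrt X.average)⁻¹ *
        transposeIn V ((X.prob i : ℂ) • X.state i) * (CFC.sqrt X.average)⁻¹ := fun i => by
      rw [prepOp, transposeIn_smul, Matrix.mul_smul, Matrix.smul_mul]
    simp_rw [h]
    rw [← Finset.sum_mul, ← Finset.mul_sum, ← transposeIn_sum]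
    change _ * transposeIn V X.average * _ = _
    -- The choice of an eigenbasis of ρ matters here: without it the sum would contain the transpose
    -- of ρ and need not be 1.
    rw [hfix, sqrt_inv_mul_mul_sqrt_inv hρ]

/-- The operator on Alice's side that corresponds to the effect `K` on the prepared system. -/
noncomputable def steer (V ρ K : Matrix n n ℂ) : Matrix n n ℂ :=
  CFC.sqrt ρ * transposeIn V K * CFC.sqrt ρ

lemma steer_posSemidef (V ρ : Matrix n n ℂ) {K : Matrix n n ℂ} (hK : K.PosSemidef) :
    (steer V ρ K).PosSemidef := by
  have h := (transposeIn_posSemidef (V := V) hK).mul_mul_conjTranspose_same (CFC.sqrt ρ)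
  rwa [(posSemidef_sqrt ρ).isHermitian.eq] at h

lemma steer_sum {α : Type*} (s : Finset α) (V ρ : Matrix n n ℂ) (K : α → Matrix n n ℂ) :
    steer V ρ (∑ a ∈ s, K a) = ∑ a ∈ s, steer V ρ (K a) := by
  simp only [steer, transposeIn_sum, Finset.mul_sum, Finset.sum_mul]

/-- The factors ρ^{1/2} and ρ^{-1/2} cancel; the transpose reverses products and preserves the
trace. -/
lemma trace_steer_mul_prepOp {V : Matrix n n ℂ} (hV : V ∈ Matrix.unitaryGroup n ℂ)
    (X : Ensemble ι n) (hρ : X.average.PosDef) (K : Matrix n n ℂ) (i : ι) :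
    (steer V X.average K * prepOp V X i).trace = X.prob i * (X.state i * K).trace := by
  have h := isUnit_sqrt_det hρ
  rw [prepOp, steer, Matrix.mul_smul, Matrix.trace_smul, smul_eq_mul,
    ← trace_transposeIn hV (X.state i * K), transposeIn_mul hV]
  congr 1
  generalize CFC.sqrt X.average = R at h
  calc (R * transposeIn V K * R * (R⁻¹ * transposeIn V (X.state i) * R⁻¹)).trace
      = (R * (transposeIn V K * (R * R⁻¹) * transposeIn V (X.state i) * R⁻¹)).trace := by
        simp only [mul_assoc]
    _ = (transposeIn V K * transposeIn V (X.state i) * (R⁻¹ * R)).trace := by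
        rw [Matrix.mul_nonsing_inv _ h, mul_one, Matrix.trace_mul_comm]
        simp only [mul_assoc]
    _ = _ := by rw [Matrix.nonsing_inv_mul _ h, mul_one]

/-- The isometry `v ↦ v ⊗ Ω`. -/
def Attack.embed (A : Attack n e) : Matrix (n × e) n ℂ :=
  Matrix.of fun x b => if x.1 = b then A.Ω x.2 else 0

lemma Attack.embed_conjTranspose_mul (A : Attack n e) : A.embedᴴ * A.embed = 1 := by
  ext b b'
  have h : ∑ x, star (A.Ω x) * A.Ω x = 1 := A.Ω_unit
  simp only [Matrix.mul_apply, Matrix.conjTranspose_apply, Attack.embed, Matrix.of_apply,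
    Fintype.sum_prod_type, apply_ite star, star_zero, ite_mul, zero_mul, mul_ite, mul_zero]
  rw [Matrix.one_apply, Finset.sum_eq_single b]
  · by_cases hb : b = b' <;> simp [hb]
    simpa using h
  · intro a _ ha
    simp [ha]
  · simp

lemma Attack.embed_mul_mul (A : Attack n e) (τ : Matrix n n ℂ) :
    A.embed * τ * A.embedᴴ = τ ⊗ₖ Matrix.vecMulVec A.Ω (star A.Ω) := by
  ext ⟨a, x⟩ ⟨a', x'⟩
  simp only [Matrix.mul_apply, Matrix.conjTranspose_apply, Attack.embed, Matrix.of_apply,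
    Matrix.kroneckerMap_apply, Matrix.vecMulVec_apply, apply_ite star, star_zero, ite_mul,
    zero_mul, mul_ite, mul_zero, Finset.sum_ite_eq, Finset.mem_univ, if_true, Pi.star_apply]
  ring

/-- The effect on the input of the attack that corresponds to the effect `Q` on its output. -/
def Attack.pullback (A : Attack n e) (Q : Matrix (n × e) (n × e) ℂ) : Matrix n n ℂ :=
  (A.U * A.embed)ᴴ * Q * (A.U * A.embed)

lemma Attack.trace_output_mul (A : Attack n e) (τ : Matrix n n ℂ)
    (Q : Matrix (n × e) (n × e) ℂ) :
    (A.output τ * Q).trace = (τ * A.pullback Q).trace := by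
  rw [Attack.output, ← A.embed_mul_mul, Attack.pullback, Matrix.conjTranspose_mul]
  calc _ = (A.U * A.embed * (τ * (A.embedᴴ * A.Uᴴ * Q))).trace := by
        simp only [Matrix.mul_assoc]
    _ = _ := by
        rw [Matrix.trace_mul_comm]; simp only [Matrix.mul_assoc]

lemma Attack.pullback_posSemidef (A : Attack n e) {Q : Matrix (n × e) (n × e) ℂ}
    (hQ : Q.PosSemidef) : (A.pullback Q).PosSemidef :=
  hQ.conjTranspose_mul_mul_same _

lemma Attack.pullback_sum {α : Type*} (s : Finset α) (A : Attack n e)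
    (Q : α → Matrix (n × e) (n × e) ℂ) :
    A.pullback (∑ a ∈ s, Q a) = ∑ a ∈ s, A.pullback (Q a) := by
  simp only [Attack.pullback, Matrix.mul_sum, Matrix.sum_mul]

lemma Attack.pullback_one (A : Attack n e) : A.pullback 1 = 1 := by
  rw [Attack.pullback, Matrix.mul_one, Matrix.conjTranspose_mul, Matrix.mul_assoc,
    ← Matrix.mul_assoc A.Uᴴ, conjTranspose_mul_of_mem_unitaryGroup A.U_unitary, Matrix.one_mul,
    A.embed_conjTranspose_mul]

end Preparation

/-! ### Joint distributions and optimal gains -/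

section Gains

lemma Ensemble.trace_average {ι n : Type*} [Fintype ι] [Fintype n] (X : Ensemble ι n) : X.average.trace = 1 := by
  simp only [Ensemble.average, Matrix.trace_sum, Matrix.trace_smul, (X.state_density _).2,
    smul_eq_mul, mul_one]
  exact_mod_cast X.sum_prob

lemma sum_kronecker_right {γ n e : Type*} [Fintype γ] [Fintype e] [DecidableEq e] (P : Matrix n n ℂ) (Z : POVM γ e) :
    ∑ z, P ⊗ₖ Z.effect z = P ⊗ₖ (1 : Matrix e e ℂ) := by
  rw [← Z.sum_effect]
  ext ⟨a, x⟩ ⟨a', x'⟩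
  simp [Matrix.sum_apply, Finset.mul_sum]

lemma sum_kronecker_left {β n e : Type*} [Fintype β] [Fintype n] [DecidableEq n] (M : POVM β n) (Q : Matrix e e ℂ) :
    ∑ b, M.effect b ⊗ₖ Q = (1 : Matrix n n ℂ) ⊗ₖ Q := by
  rw [← M.sum_effect]
  ext ⟨a, x⟩ ⟨a', x'⟩
  simp [Matrix.sum_apply, Finset.sum_mul]

variable {ι κ β γ n e : Type*} [Fintype ι] [Fintype κ] [Fintype β] [Fintype γ] [Fintype n]
  [DecidableEq n] [Fintype e] [DecidableEq e]

/-- Bob's statistics are a marginal: Eve's effects sum to 1, so any `Z` may be measured alongside.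
The steered operators depend on the ensemble only through its average, hence serve X and Y alike. -/
lemma bobJoint_eq_sum {V : Matrix n n ℂ} (hV : V ∈ Matrix.unitaryGroup n ℂ) (X : Ensemble ι n)
    (hρ : X.average.PosDef) (A : Attack n e) (M : POVM β n) (Z : POVM γ e) (i : ι) (b : β) :
    bobJoint X A M i b = ∑ z, (steer V X.average (A.pullback (M.effect b ⊗ₖ Z.effect z))
      * prepOp V X i).trace.re := by
  rw [bobJoint, A.trace_output_mul, ← sum_kronecker_right _ Z, A.pullback_sum, ← Complex.re_sum]
  simp_rw [trace_steer_mul_prepOp hV X hρ]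
  rw [← Finset.mul_sum, ← Matrix.trace_sum, ← Matrix.mul_sum, Complex.re_ofReal_mul]

lemma eveJoint_eq_sum {V : Matrix n n ℂ} (hV : V ∈ Matrix.unitaryGroup n ℂ) (X : Ensemble ι n)
    (hρ : X.average.PosDef) (A : Attack n e) (M : POVM β n) (Z : POVM γ e) (i : ι) (z : γ) :
    eveJoint X A Z i z = ∑ b, (steer V X.average (A.pullback (M.effect b ⊗ₖ Z.effect z))
      * prepOp V X i).trace.re := by
  rw [eveJoint, A.trace_output_mul, ← sum_kronecker_left M, A.pullback_sum, ← Complex.re_sum]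
  simp_rw [trace_steer_mul_prepOp hV X hρ]
  rw [← Finset.mul_sum, ← Matrix.trace_sum, ← Matrix.mul_sum, Complex.re_ofReal_mul]

lemma sum_trace_steer {V : Matrix n n ℂ} (hV : V ∈ Matrix.unitaryGroup n ℂ) (X : Ensemble ι n)
    (hρ : X.average.PosDef) (A : Attack n e) (M : POVM β n) (Z : POVM γ e) :
    ∑ b, ∑ z, (steer V X.average (A.pullback (M.effect b ⊗ₖ Z.effect z))).trace.re = 1 := by
  simp_rw [← Complex.re_sum, ← Matrix.trace_sum, ← steer_sum, ← A.pullback_sum,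
    sum_kronecker_right, sum_kronecker_left, Matrix.one_kronecker_one, A.pullback_one]
  rw [steer, transposeIn_one hV, mul_one, CFC.sqrt_mul_sqrt_self _ hρ.posSemidef.nonneg,
    X.trace_average, Complex.one_re]

lemma Attack.trace_output (A : Attack n e) (τ : Matrix n n ℂ) : (A.output τ).trace = τ.trace := by
  have h := A.trace_output_mul τ 1
  rwa [mul_one, A.pullback_one, mul_one] at h

lemma Attack.output_posSemidef (A : Attack n e) {τ : Matrix n n ℂ} (hτ : τ.PosSemidef) :
    (A.output τ).PosSemidef :=
  (hτ.kronecker (Matrix.posSemidef_vecMulVec_self_star _)).mul_mul_conjTranspose_same _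

lemma bobJoint_nonneg (X : Ensemble ι n) (A : Attack n e) (M : POVM β n) (i : ι) (b : β) :
    0 ≤ bobJoint X A M i b :=
  mul_nonneg (X.prob_nonneg i) (trace_mul_re_nonneg (A.output_posSemidef (X.state_density i).1)
    ((M.effect_posSemidef b).kronecker Matrix.PosSemidef.one))

lemma eveJoint_nonneg (X : Ensemble ι n) (A : Attack n e) (Z : POVM γ e) (i : ι) (z : γ) :
    0 ≤ eveJoint X A Z i z :=
  mul_nonneg (X.prob_nonneg i) (trace_mul_re_nonneg (A.output_posSemidef (X.state_density i).1)
    (Matrix.PosSemidef.one.kronecker (Z.effect_posSemidef z)))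

lemma sum_bobJoint (X : Ensemble ι n) (A : Attack n e) (M : POVM β n) (i : ι) :
    ∑ b, bobJoint X A M i b = X.prob i := by
  simp only [bobJoint]
  rw [← Finset.mul_sum, ← Complex.re_sum, ← Matrix.trace_sum, ← Matrix.mul_sum,
    sum_kronecker_left, Matrix.one_kronecker_one, mul_one, A.trace_output,
    (X.state_density i).2, Complex.one_re, mul_one]

lemma sum_eveJoint (X : Ensemble ι n) (A : Attack n e) (Z : POVM γ e) (i : ι) :
    ∑ z, eveJoint X A Z i z = X.prob i := by
  simp only [eveJoint]
  rw [← Finset.mul_sum, ← Complex.re_sum, ← Matrix.trace_sum, ← Matrix.mul_sum,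
    sum_kronecker_right, Matrix.one_kronecker_one, mul_one, A.trace_output,
    (X.state_density i).2, Complex.one_re, mul_one]

/-- The information exclusion relation for two fixed measurements. -/
lemma mutualInfo_bob_add_eve_le {r : ℝ} (hr : 1 < r) {ρ V : Matrix n n ℂ} (hρ : ρ.PosDef)
    (hV : V ∈ Matrix.unitaryGroup n ℂ) (hfix : transposeIn V ρ = ρ)
    (X : Ensemble ι n) (Y : Ensemble κ n) (hX : X.average = ρ) (hY : Y.average = ρ)
    (A : Attack n e) (M : POVM β n) (Z : POVM γ e) :
    mutualInfo r (bobJoint X A M) + mutualInfo r (eveJoint Y A Z) ≤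
      entropy r X.prob + entropy r Y.prob
        + 2 * Real.logb r (overlap (prepOp V X) (prepOp V Y)) ∧
    mutualInfo r (eveJoint X A Z) + mutualInfo r (bobJoint Y A M) ≤
      entropy r X.prob + entropy r Y.prob
        + 2 * Real.logb r (overlap (prepOp V X) (prepOp V Y)) := by
  have hrX : X.average.PosDef := hX ▸ hρ
  have hrY : Y.average.PosDef := hY ▸ hρ
  let F := prepPOVM V X hrX (hX.symm ▸ hfix)
  let G := prepPOVM V Y hrY (hY.symm ▸ hfix)
  let ω : β → γ → Matrix n n ℂ := fun b z => steer V ρ (A.pullback (M.effect b ⊗ₖ Z.effect z))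
  have hω : ∀ b z, (ω b z).PosSemidef := fun b z => steer_posSemidef V ρ
    (A.pullback_posSemidef ((M.effect_posSemidef b).kronecker (Z.effect_posSemidef z)))
  have hω1 : ∑ b, ∑ z, (ω b z).trace.re = 1 := by
    have := sum_trace_steer hV X hrX A M Z
    rwa [hX] at this
  have hbX := bobJoint_eq_sum hV X hrX A M Z
  have heX := eveJoint_eq_sum hV X hrX A M Z
  have hbY := bobJoint_eq_sum hV Y hrY A M Z
  have heY := eveJoint_eq_sum hV Y hrY A M Z
  rw [hX] at hbX heX
  rw [hY] at hbY heY
  have h1 := condLogSum_add_le F G ω hω hω1 (bobJoint X A M) hbX (eveJoint Y A Z) heY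
  -- Now Eve's outcome is the memory for X and Bob's the memory for Y, so the two indices of `ω` are
  -- exchanged.
  have h2 := condLogSum_add_le F G (fun z b => ω b z) (fun z b => hω b z)
    (by rw [Finset.sum_comm]; exact hω1) (eveJoint X A Z) heX (bobJoint Y A M) hbY
  have hlog : 0 < Real.log r := Real.log_pos hr
  have aux : ∀ {s t : ℝ}, s + t ≤ 2 * Real.log (overlap (prepOp V X) (prepOp V Y)) →
      s / Real.log r + t / Real.log r
        ≤ 2 * Real.logb r (overlap (prepOp V X) (prepOp V Y)) := by
    intro s t h
    rw [← add_div, Real.logb, ← mul_div_assoc]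
    gcongr
  rw [mutualInfo_eq r _ (bobJoint_nonneg X A M), mutualInfo_eq r _ (eveJoint_nonneg Y A Z),
    mutualInfo_eq r _ (eveJoint_nonneg X A Z), mutualInfo_eq r _ (bobJoint_nonneg Y A M)]
  -- The label's marginal does not depend on attack or measurement, so the entropies become H(X) and
  -- H(Y).
  simp_rw [sum_bobJoint, sum_eveJoint]
  have h1' := aux h1
  have h2' := aux h2
  exact ⟨by linarith, by linarith⟩

/-- The measurement with a single outcome. -/
def trivialPOVM (n : Type*) [Fintype n] [DecidableEq n] : POVM (Fin 1) n where
  effect _ := 1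
  effect_posSemidef _ := Matrix.PosSemidef.one
  sum_effect := by simp

lemma bobGains_nonempty (r : ℝ) (X : Ensemble ι n) (A : Attack n e) : (bobGains r X A).Nonempty :=
  ⟨_, 1, trivialPOVM n, rfl⟩

lemma eveGains_nonempty (r : ℝ) (X : Ensemble ι n) (A : Attack n e) : (eveGains r X A).Nonempty :=
  ⟨_, 1, trivialPOVM e, rfl⟩

/-- Two nonempty sets of reals with bounded pairwise sums are bounded, with the same bound for the
sum of the suprema. -/
lemma bddAbove_and_csSup_add_le {S T : Set ℝ} (hS : S.Nonempty) (hT : T.Nonempty) {C : ℝ}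
    (h : ∀ s ∈ S, ∀ t ∈ T, s + t ≤ C) :
    BddAbove S ∧ BddAbove T ∧ sSup S + sSup T ≤ C := by
  obtain ⟨s₀, hs₀⟩ := hS
  obtain ⟨t₀, ht₀⟩ := hT
  refine ⟨⟨C - t₀, fun s hs => by linarith [h s hs t₀ ht₀]⟩,
    ⟨C - s₀, fun t ht => by linarith [h s₀ hs₀ t ht]⟩, ?_⟩
  have h1 : ∀ t ∈ T, sSup S ≤ C - t := fun t ht =>
    csSup_le ⟨s₀, hs₀⟩ fun s hs => by linarith [h s hs t ht]
  have h2 : sSup T ≤ C - sSup S := csSup_le ⟨t₀, ht₀⟩ fun t ht => by linarith [h1 t ht]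
  linarith

end Gains

end QInfo

theorem theorem2 {n e ι κ : Type*} [Fintype n] [DecidableEq n] [Fintype e] [DecidableEq e]
    [Fintype ι] [Fintype κ]
    -- the base of the logarithms
    (r : ℝ) (hr : 1 < r)
    -- the state, of full rank, and an orthonormal eigenbasis of it (the columns of `V`)
    (ρ : Matrix n n ℂ) (hρ : ρ.PosDef)
    (V : Matrix n n ℂ) (hV : V ∈ Matrix.unitaryGroup n ℂ) (lam : n → ℝ)
    (hdiag : ρ = V * Matrix.diagonal (fun k => (lam k : ℂ)) * Vᴴ)
    -- the two ways to prepare it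
    (X : QInfo.Ensemble ι n) (Y : QInfo.Ensemble κ n)
    (hX : X.average = ρ) (hY : Y.average = ρ)
    -- the attack
    (A : QInfo.Attack n e) :
    -- the four optimal information gains are suprema of bounded sets
    (BddAbove (QInfo.bobGains r X A) ∧ BddAbove (QInfo.eveGains r X A) ∧
      BddAbove (QInfo.bobGains r Y A) ∧ BddAbove (QInfo.eveGains r Y A)) ∧
    QInfo.infoBob r X A + QInfo.infoEve r Y A ≤
      QInfo.entropy r X.prob + QInfo.entropy r Y.prob
        + 2 * Real.logb r (QInfo.overlap (QInfo.prepOp V X) (QInfo.prepOp V Y)) ∧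
    QInfo.infoEve r X A + QInfo.infoBob r Y A ≤
      QInfo.entropy r X.prob + QInfo.entropy r Y.prob
        + 2 * Real.logb r (QInfo.overlap (QInfo.prepOp V X) (QInfo.prepOp V Y)) := by
  have hfix : QInfo.transposeIn V ρ = ρ := by
    rw [hdiag]; exact QInfo.transposeIn_diagonal hV _
  have h := fun (m : ℕ) (M : QInfo.POVM (Fin m) n) (k : ℕ) (Z : QInfo.POVM (Fin k) e) =>
    QInfo.mutualInfo_bob_add_eve_le hr hρ hV hfix X Y hX hY A M Z
  -- The measurements of Bob and Eve are chosen independently, so the bound passes to both suprema;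
  -- finiteness comes from fixing one gain in the other set.
  obtain ⟨hbX, heY, h1⟩ := QInfo.bddAbove_and_csSup_add_le
    (QInfo.bobGains_nonempty r X A) (QInfo.eveGains_nonempty r Y A) (by
      rintro _ ⟨m, M, rfl⟩ _ ⟨k, Z, rfl⟩
      exact (h m M k Z).1)
  obtain ⟨heX, hbY, h2⟩ := QInfo.bddAbove_and_csSup_add_le
    (QInfo.eveGains_nonempty r X A) (QInfo.bobGains_nonempty r Y A) (by
      rintro _ ⟨k, Z, rfl⟩ _ ⟨m, M, rfl⟩
      exact (h m M k Z).2)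
  exact ⟨⟨hbX, heX, hbY, heY⟩, h1, h2⟩
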